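/- Let $\mathbb{T}^2=(\mathbb{R}/2\pi\mathbb{Z})^2$, $T>0$, $\nu>0$. Let $\beta_0\in C^\infty(\mathbb{T}^2)$, $g\in C^\infty(\mathbb{T}^2\times[0,T])$ and $U\in C^\infty(\mathbb{T}^2\times[0,T];\mathbb{R}^2)$ be such that $\operatorname{div}U(\cdot,t)=0$ and $\int_{\mathbb{T}^2}g(x,t)\,dx=0$ for all $t\in[0,T]$, and $\int_{\mathbb{T}^2}\beta_0\,dx=0$. Let $\beta\in C^\infty(\mathbb{T}^2\times[0,T])$ be the solution of $$\partial_t\beta+U\cdot\nabla\beta=\nu\Delta\beta+g\quad\text{in }\mathbb{T}^2\times(0,T),\qquad \beta(\cdot,0)=\beta_0 .$$ For $0\le t_0\le t\le T$ let $E(t;t_0)$ denote the solution operator of the transport equation, i.e. $t\mapsto E(t;t_0)b$ is the smooth solution on $[t_0,T]$ of $\partial_t w+U\cdot\nabla w=0$, $w(\cdot,t_0)=b$, and let $H(t;t_0)$ denote the solution operator of the forced heat equation, i.e. $t\mapsto H(t;t_0)b$ is the smooth solution on $[t_0,T]$ of $\partial_t w=\nu\Delta w+g$, $w(\cdot,t_0)=b$.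 For an integer $N\ge1$ put $\Delta t=T/N$, $t_n=n\Delta t$, and define the splitting approximant $\beta^\Delta$ on $[0,T]$ by $\beta^\Delta(0)=\beta_0$ and, recursively for $n=0,\dots,N-1$, $$\beta^\Delta(t)=H(t;t_n)\big[E(t;t_n)\,\beta^\Delta(t_n)\big],\qquad t\in(t_n,t_{n+1}].$$ Then $$\lim_{\Delta t\to0}\ \|\beta-\beta^\Delta\|_{L^\infty_tL^2_x}=0,\qquad\text{where}\quad \|w\|_{L^\infty_tL^2_x}=\sup_{t\in[0,T]}\|w(\cdot,t)\|_{L^2(\mathbb{T}^2)}$$ and the limit is taken along $\Delta t=T/N$, $N\to\infty$. -/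

import Mathlib

open scoped ContDiff

noncomputable section

namespace AdvDiff

/-- The plane, with coordinates `x 0`, `x 1`. Functions on the torus `𝕋² = (ℝ / 2πℤ)²` are
`2π`-periodic functions on the plane. -/
abbrev Plane : Type := Fin 2 → ℝ

/-- `f` is `2π`-periodic in each of the two coordinates, that is, a function on `𝕋²`. -/
def TorusPeriodic {E : Type*} (f : Plane → E) : Prop :=
  ∀ i : Fin 2, Function.Periodic f (Pi.single i (2 * Real.pi))

/-- `f ∈ C^∞(𝕋²)`. -/
structure SmoothOnTorus {E : Type*} [NormedAddCommGroup E] [NormedSpace ℝ E]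
    (f : Plane → E) : Prop where
  periodic : TorusPeriodic f
  smooth : ContDiff ℝ ∞ f

/-- `f ∈ C^∞(𝕋² × [a, b])`, jointly smooth up to the end points of the time interval.
The time variable is written first. -/
structure SmoothOnTorusTime {E : Type*} [NormedAddCommGroup E] [NormedSpace ℝ E]
    (a b : ℝ) (f : ℝ → Plane → E) : Prop where
  periodic : ∀ t ∈ Set.Icc a b, TorusPeriodic (f t)
  smooth : ContDiffOn ℝ ∞ (fun p : ℝ × Plane => f p.1 p.2) (Set.Icc a b ×ˢ Set.univ)

/-- The partial derivative `∂f/∂xᵢ` at `x`. -/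
def pderiv (i : Fin 2) (f : Plane → ℝ) (x : Plane) : ℝ :=
  fderiv ℝ f x (Pi.single i 1)

/-- `(V · ∇ f)(x)`. -/
def advect (V : Plane → Plane) (f : Plane → ℝ) (x : Plane) : ℝ :=
  ∑ i, V x i * pderiv i f x

/-- `(Δ f)(x)`. -/
def laplace (f : Plane → ℝ) (x : Plane) : ℝ :=
  ∑ i, pderiv i (pderiv i f) x

/-- `(div V)(x)`. -/
def divergence (V : Plane → Plane) (x : Plane) : ℝ :=
  ∑ i, pderiv i (fun y => V y i) x

/-- The fundamental cell `[0, 2π]²` of the torus. -/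
def cell : Set Plane := Set.Icc 0 (fun _ => 2 * Real.pi)

/-- Lebesgue measure of the torus, as Lebesgue measure on the fundamental cell. -/
def torusMeasure : MeasureTheory.Measure Plane := MeasureTheory.volume.restrict cell

/-- `f` has zero mean: `∫_{𝕋²} f dx = 0`. -/
def ZeroMean (f : Plane → ℝ) : Prop := ∫ x, f x ∂torusMeasure = 0

/-- `‖w‖_{L^∞_t L²_x}` over `𝕋² × [0, T]`, with the supremum over all times in `[0, T]`
(it dominates the essential supremum, and equals it for functions continuous in time). -/
def normLinftyL2 (T : ℝ) (w : ℝ → Plane → ℝ) : ENNReal :=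
  ⨆ t ∈ Set.Icc (0 : ℝ) T, MeasureTheory.eLpNorm (w t) 2 torusMeasure

/-- `β` is a smooth solution on `𝕋² × [0, T]` of
`∂ₜ β + U · ∇ β = ν Δ β + g`, `β(0) = β₀`. -/
structure IsAdvectionDiffusionSolution (ν T : ℝ) (U : ℝ → Plane → Plane) (g : ℝ → Plane → ℝ)
    (β₀ : Plane → ℝ) (β : ℝ → Plane → ℝ) : Prop where
  smooth : SmoothOnTorusTime 0 T β
  initial : β 0 = β₀
  equation : ∀ t ∈ Set.Ioo 0 T, ∀ x,
    deriv (fun s => β s x) t + advect (U t) (β t) x = ν * laplace (β t) x + g t x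

/-- `β` is a smooth solution on `𝕋² × [t₀, T]` of the transport equation
`∂ₜ β + U · ∇ β = 0`, `β(t₀) = b`. -/
structure IsTransportSolution (T : ℝ) (U : ℝ → Plane → Plane) (t₀ : ℝ)
    (b : Plane → ℝ) (β : ℝ → Plane → ℝ) : Prop where
  smooth : SmoothOnTorusTime t₀ T β
  initial : β t₀ = b
  equation : ∀ t ∈ Set.Ioo t₀ T, ∀ x,
    deriv (fun s => β s x) t + advect (U t) (β t) x = 0

/-- `β` is a smooth solution on `𝕋² × [t₀, T]` of the forced heat equation
`∂ₜ β = ν Δ β + g`, `β(t₀) = b`. -/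
structure IsHeatSolution (ν T : ℝ) (g : ℝ → Plane → ℝ) (t₀ : ℝ)
    (b : Plane → ℝ) (β : ℝ → Plane → ℝ) : Prop where
  smooth : SmoothOnTorusTime t₀ T β
  initial : β t₀ = b
  equation : ∀ t ∈ Set.Ioo t₀ T, ∀ x,
    deriv (fun s => β s x) t = ν * laplace (β t) x + g t x

/-- The graph of the solution operator `E(t; t₀)` of the transport equation on `[t₀, T]`:
`c = E(t; t₀) b`. -/
def TransportOp (T : ℝ) (U : ℝ → Plane → Plane) (t₀ t : ℝ) (b c : Plane → ℝ) : Prop :=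
  ∃ β, IsTransportSolution T U t₀ b β ∧ c = β t

/-- The graph of the solution operator `H(t; t₀)` of the forced heat equation on `[t₀, T]`:
`c = H(t; t₀) b`. -/
def HeatOp (ν T : ℝ) (g : ℝ → Plane → ℝ) (t₀ t : ℝ) (b c : Plane → ℝ) : Prop :=
  ∃ β, IsHeatSolution ν T g t₀ b β ∧ c = β t

/-- The grid point `tₙ = n Δt`, with `Δt = T / N`. -/
def gridTime (T : ℝ) (N n : ℕ) : ℝ := n * (T / N)

/-- `B` is the Lie splitting approximant on `[0, T]` with `N` steps of size `Δt = T / N`: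
`B(0) = β₀`, and for `n < N` and `t ∈ (tₙ, tₙ₊₁]`,
`B(t) = H(t; tₙ) m(t)`, where `m(t) = E(t; tₙ) B(tₙ)`. -/
structure IsSplittingApproximant (ν T : ℝ) (U : ℝ → Plane → Plane) (g : ℝ → Plane → ℝ)
    (β₀ : Plane → ℝ) (N : ℕ) (B : ℝ → Plane → ℝ) : Prop where
  initial : B 0 = β₀
  step : ∀ n < N, ∀ t ∈ Set.Ioc (gridTime T N n) (gridTime T N (n + 1)),
    ∃ m : Plane → ℝ, TransportOp T U (gridTime T N n) t (B (gridTime T N n)) m ∧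
      HeatOp ν T g (gridTime T N n) t m (B t)

end AdvDiff

end

/-! The argument is consistency plus stability, carried out in the sup norm, which dominates the L²
norm on the torus because its measure is finite. Stability is the maximum principle
`le_of_parabolic_le`: for `∂ₜ + V · ∇ - κΔ` with `κ ≥ 0`, the sup distance of two functions grows at
most by their difference of residuals times the elapsed time. The initial distance enters with
factor exactly one, so errors from successive steps add and are never amplified. For consistency on
a step `[a, t]` of length `τ`, put `v = U(a) · ∇β(a)` and `q = νΔβ(a) + g(a)`. Transport carries
`β(a)` to `β(a) - τ v + o(τ)`, the heat flow carries this to `β(a) - τ v + τ q + o(τ)`, and `β(t)`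
has the same expansion. Only derivatives of the exact solution occur, so no bounds on derivatives of
the approximant, uniform in `N`, are needed; compactness makes `o(τ)` uniform in `a`. Summing `ε τ`
over the steps bounds the error by `ε T`. -/

namespace AdvDiff

/-! ### Smoothness up to the ends of the time interval, and linearity of the operators. -/

section Regularity

variable {a b : ℝ}

theorem SmoothOnTorusTime.slice {E : Type*} [NormedAddCommGroup E] [NormedSpace ℝ E]
    {f : ℝ → Plane → E} (hf : SmoothOnTorusTime a b f) {t : ℝ} (ht : t ∈ Set.Icc a b) :
    ContDiff ℝ ∞ (f t) := by
  rw [← contDiffOn_univ]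
  exact hf.smooth.comp (f := fun x : Plane => (t, x))
    (contDiff_const.prodMk contDiff_id).contDiffOn fun x _ => ⟨ht, trivial⟩

theorem SmoothOnTorusTime.slice_torus {E : Type*} [NormedAddCommGroup E] [NormedSpace ℝ E]
    {f : ℝ → Plane → E} (hf : SmoothOnTorusTime a b f) {t : ℝ} (ht : t ∈ Set.Icc a b) :
    SmoothOnTorus (f t) :=
  ⟨hf.periodic t ht, hf.slice ht⟩

theorem SmoothOnTorusTime.contDiffOn_time {f : ℝ → Plane → ℝ} (hf : SmoothOnTorusTime a b f)
    (x : Plane) : ContDiffOn ℝ ∞ (fun s => f s x) (Set.Icc a b) :=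
  hf.smooth.comp (f := fun s : ℝ => (s, x))
    (contDiff_id.prodMk contDiff_const).contDiffOn fun _ hs => ⟨hs, trivial⟩

theorem SmoothOnTorusTime.differentiableAt_time {f : ℝ → Plane → ℝ}
    (hf : SmoothOnTorusTime a b f) (x : Plane) {t : ℝ} (ht : t ∈ Set.Ioo a b) :
    DifferentiableAt ℝ (fun s => f s x) t :=
  ((hf.contDiffOn_time x).differentiableOn (by simp)).differentiableAt
    (Icc_mem_nhds ht.1 ht.2)

theorem SmoothOnTorusTime.mono {f : ℝ → Plane → ℝ} (hf : SmoothOnTorusTime a b f) {c d : ℝ}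
    (h : Set.Icc c d ⊆ Set.Icc a b) : SmoothOnTorusTime c d f :=
  ⟨fun t ht => hf.periodic t (h ht), hf.smooth.mono (Set.prod_mono h subset_rfl)⟩

theorem SmoothOnTorusTime.component {U : ℝ → Plane → Plane} (hU : SmoothOnTorusTime a b U)
    (i : Fin 2) : SmoothOnTorusTime a b (fun t x => U t x i) :=
  ⟨fun t ht j x => congrFun (hU.periodic t ht j x) i, contDiffOn_pi.1 hU.smooth i⟩

theorem SmoothOnTorusTime.add {f g : ℝ → Plane → ℝ} (hf : SmoothOnTorusTime a b f)
    (hg : SmoothOnTorusTime a b g) : SmoothOnTorusTime a b (fun t x => f t x + g t x) :=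
  ⟨fun t ht i => (hf.periodic t ht i).add (hg.periodic t ht i), hf.smooth.add hg.smooth⟩

theorem SmoothOnTorusTime.sub {f g : ℝ → Plane → ℝ} (hf : SmoothOnTorusTime a b f)
    (hg : SmoothOnTorusTime a b g) : SmoothOnTorusTime a b (fun t x => f t x - g t x) :=
  ⟨fun t ht i => (hf.periodic t ht i).sub (hg.periodic t ht i), hf.smooth.sub hg.smooth⟩

theorem SmoothOnTorusTime.mul {f g : ℝ → Plane → ℝ} (hf : SmoothOnTorusTime a b f)
    (hg : SmoothOnTorusTime a b g) : SmoothOnTorusTime a b (fun t x => f t x * g t x) :=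
  ⟨fun t ht i => (hf.periodic t ht i).mul (hg.periodic t ht i), hf.smooth.mul hg.smooth⟩

theorem SmoothOnTorus.smoothOnTorusTime {f : Plane → ℝ} (hf : SmoothOnTorus f) :
    SmoothOnTorusTime a b (fun _ => f) :=
  ⟨fun _ _ => hf.periodic, (hf.smooth.comp contDiff_snd).contDiffOn⟩

theorem smoothOnTorusTime_of_contDiff {c : ℝ → ℝ} (hc : ContDiff ℝ ∞ c) :
    SmoothOnTorusTime a b (fun t _ => c t) :=
  ⟨fun _ _ _ _ => rfl, (hc.comp contDiff_fst).contDiffOn⟩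

theorem torusPeriodic_pderiv {f : Plane → ℝ} (hf : TorusPeriodic f) (i : Fin 2) :
    TorusPeriodic (pderiv i f) := by
  intro j x
  have h : (fun y => f (y + Pi.single j (2 * Real.pi))) = f := funext (hf j)
  unfold pderiv
  rw [← fderiv_comp_add_right, h]

/-- The spatial derivative is the joint derivative within the slab applied to `(0, eᵢ)`.
Nondegeneracy of the interval makes that derivative unique, hence smooth, at the end times too. -/
theorem SmoothOnTorusTime.pderiv (hab : a < b) {f : ℝ → Plane → ℝ}
    (hf : SmoothOnTorusTime a b f) (i : Fin 2) :
    SmoothOnTorusTime a b (fun t => pderiv i (f t)) := by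
  refine ⟨fun t ht => torusPeriodic_pderiv (hf.periodic t ht) i, ?_⟩
  have hu : UniqueDiffOn ℝ (Set.Icc a b ×ˢ (Set.univ : Set Plane)) :=
    (uniqueDiffOn_Icc hab).prod uniqueDiffOn_univ
  have h := (hf.smooth.fderivWithin hu (m := ∞) (by simp)).clm_apply
    (contDiffOn_const (c := ((0 : ℝ), (Pi.single i 1 : Plane))))
  refine h.congr fun p hp => ?_
  have hd : HasFDerivWithinAt (fun p : ℝ × Plane => f p.1 p.2) _ _ p :=
    ((hf.smooth.differentiableOn (by simp)) p hp).hasFDerivWithinAt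
  have hc : HasFDerivAt (fun x : Plane => (p.1, x)) (ContinuousLinearMap.inr ℝ ℝ Plane) p.2 :=
    hasFDerivAt_prodMk_right p.1 p.2
  have := HasFDerivWithinAt.comp (t := Set.Icc a b ×ˢ (Set.univ : Set Plane)) p.2 hd
    (hc.hasFDerivWithinAt (s := Set.univ)) (fun x _ => ⟨hp.1, trivial⟩)
  rw [hasFDerivWithinAt_univ] at this
  simp only [AdvDiff.pderiv]
  have h2 : fderiv ℝ (f p.1) p.2 = _ := this.fderiv
  rw [h2]
  simp

theorem SmoothOnTorusTime.laplace (hab : a < b) {f : ℝ → Plane → ℝ}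
    (hf : SmoothOnTorusTime a b f) : SmoothOnTorusTime a b (fun t => laplace (f t)) := by
  have h := ((hf.pderiv hab 0).pderiv hab 0).add ((hf.pderiv hab 1).pderiv hab 1)
  have e : (fun t => AdvDiff.laplace (f t)) = _ :=
    funext fun t => funext fun x => Fin.sum_univ_two fun i => AdvDiff.pderiv i (AdvDiff.pderiv i (f t)) x
  rw [e]
  exact h

theorem SmoothOnTorusTime.advect (hab : a < b) {U : ℝ → Plane → Plane} {f : ℝ → Plane → ℝ}
    (hU : SmoothOnTorusTime a b U) (hf : SmoothOnTorusTime a b f) :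
    SmoothOnTorusTime a b (fun t => advect (U t) (f t)) := by
  have h := ((hU.component 0).mul (hf.pderiv hab 0)).add ((hU.component 1).mul (hf.pderiv hab 1))
  have e : (fun t => AdvDiff.advect (U t) (f t)) = _ :=
    funext fun t => funext fun x => Fin.sum_univ_two fun i => U t x i * AdvDiff.pderiv i (f t) x
  rw [e]
  exact h

theorem contDiff_pderiv {f : Plane → ℝ} (hf : ContDiff ℝ ∞ f) (i : Fin 2) :
    ContDiff ℝ ∞ (pderiv i f) :=
  (hf.fderiv_right (m := ∞) (by simp)).clm_apply contDiff_const

theorem pderiv_add_const_mul {f g : Plane → ℝ} (hf : ContDiff ℝ ∞ f) (hg : ContDiff ℝ ∞ g)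
    (c : ℝ) (i : Fin 2) :
    pderiv i (fun x => f x + c * g x) = fun x => pderiv i f x + c * pderiv i g x := by
  funext x
  have h1 := (hf.differentiable (by simp)) x
  have h2 := (hg.differentiable (by simp)) x
  simp only [AdvDiff.pderiv]
  rw [fderiv_fun_add h1 (h2.const_mul c), fderiv_const_mul h2]
  simp

theorem advect_add_const_mul {f g : Plane → ℝ} (hf : ContDiff ℝ ∞ f) (hg : ContDiff ℝ ∞ g)
    (c : ℝ) (V : Plane → Plane) (x : Plane) :
    advect V (fun x => f x + c * g x) x = advect V f x + c * advect V g x := by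
  simp only [AdvDiff.advect, pderiv_add_const_mul hf hg, Fin.sum_univ_two]
  ring

theorem laplace_add_const_mul {f g : Plane → ℝ} (hf : ContDiff ℝ ∞ f) (hg : ContDiff ℝ ∞ g)
    (c : ℝ) (x : Plane) :
    laplace (fun x => f x + c * g x) x = laplace f x + c * laplace g x := by
  simp only [AdvDiff.laplace, pderiv_add_const_mul hf hg,
    pderiv_add_const_mul (contDiff_pderiv hf _) (contDiff_pderiv hg _), Fin.sum_univ_two]
  ring

end Regularity

/-! ### Uniform bounds and moduli of continuity by periodicity. -/

section Compactness

theorem isCompact_cell : IsCompact cell := isCompact_Icc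

/-- The point `y` does not depend on `f`, so one representative serves different time slices at
once. -/
theorem exists_mem_cell (x : Plane) :
    ∃ y ∈ cell, ∀ f : Plane → ℝ, TorusPeriodic f → f x = f y := by
  have hpi : 0 < 2 * Real.pi := by positivity
  refine ⟨x - ⌊x 0 / (2 * Real.pi)⌋ • Pi.single 0 (2 * Real.pi)
    - ⌊x 1 / (2 * Real.pi)⌋ • Pi.single 1 (2 * Real.pi), ?_, fun f hf => ?_⟩
  · have key : ∀ r : ℝ, 0 ≤ r - ⌊r / (2 * Real.pi)⌋ * (2 * Real.pi) ∧
        r - ⌊r / (2 * Real.pi)⌋ * (2 * Real.pi) ≤ 2 * Real.pi := fun r => by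
      have h1 := (le_div_iff₀ hpi).1 (Int.floor_le (r / (2 * Real.pi)))
      have h2 := (div_lt_iff₀ hpi).1 (Int.lt_floor_add_one (r / (2 * Real.pi)))
      constructor <;> linarith
    refine ⟨fun i => ?_, fun i => ?_⟩ <;> fin_cases i
    · simpa using (key (x 0)).1
    · simpa using (key (x 1)).1
    · simpa using (key (x 0)).2
    · simpa using (key (x 1)).2
  · rw [(hf 1).sub_zsmul_eq, (hf 0).sub_zsmul_eq]

variable {a b : ℝ} {f : ℝ → Plane → ℝ}

theorem SmoothOnTorusTime.exists_bound (hf : SmoothOnTorusTime a b f) :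
    ∃ C, 0 ≤ C ∧ ∀ t ∈ Set.Icc a b, ∀ x, |f t x| ≤ C := by
  obtain ⟨C, hC⟩ := ((isCompact_Icc (a := a) (b := b)).prod isCompact_cell).exists_bound_of_continuousOn
    (hf.smooth.continuousOn.mono (Set.prod_mono subset_rfl (Set.subset_univ _)))
  refine ⟨max C 0, le_max_right _ _, fun t ht x => ?_⟩
  obtain ⟨y, hy, h⟩ := exists_mem_cell x
  rw [h _ (hf.periodic t ht)]
  exact (hC (t, y) ⟨ht, hy⟩).trans (le_max_left _ _)

theorem SmoothOnTorusTime.exists_modulus (hf : SmoothOnTorusTime a b f) {ε : ℝ} (hε : 0 < ε) :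
    ∃ δ > 0, ∀ s ∈ Set.Icc a b, ∀ t ∈ Set.Icc a b, |s - t| < δ → ∀ x, |f s x - f t x| ≤ ε := by
  have hu := ((isCompact_Icc (a := a) (b := b)).prod isCompact_cell).uniformContinuousOn_of_continuous
    (hf.smooth.continuousOn.mono (Set.prod_mono subset_rfl (Set.subset_univ _)))
  obtain ⟨δ, hδ, h⟩ := Metric.uniformContinuousOn_iff.1 hu ε hε
  refine ⟨δ, hδ, fun s hs t ht hst x => ?_⟩
  obtain ⟨y, hy, hxy⟩ := exists_mem_cell x
  rw [hxy _ (hf.periodic t ht), hxy _ (hf.periodic s hs)]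
  refine (h (s, y) ⟨hs, hy⟩ (t, y) ⟨ht, hy⟩ ?_).le
  simpa [Prod.dist_eq, Real.dist_eq, hδ] using hst

end Compactness

/-! ### Maximum principle and stability in the sup norm. -/

section MaximumPrinciple

theorem pderiv_eq_deriv_line {f : Plane → ℝ} (hf : ContDiff ℝ ∞ f) (i : Fin 2) (x : Plane) (h : ℝ) :
    HasDerivAt (fun r : ℝ => f (x + r • Pi.single i 1)) (pderiv i f (x + h • Pi.single i 1)) h := by
  have h1 : HasDerivAt (fun r : ℝ => x + r • (Pi.single i 1 : Plane)) (Pi.single i 1) h := by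
    simpa using ((hasDerivAt_id h).smul_const (Pi.single i 1 : Plane)).const_add x
  exact ((hf.differentiable (by simp)) _).hasFDerivAt.comp_hasDerivAt h h1

theorem pderiv_eq_zero_of_isMax {f : Plane → ℝ} {x : Plane} (hx : ∀ y, f y ≤ f x) (i : Fin 2) :
    pderiv i f x = 0 := by
  have : IsLocalMax f x := Filter.Eventually.of_forall hx
  simp [pderiv, this.fderiv_eq_zero]

/-- A positive second derivative would make the maximum also a local minimum along the coordinate
line; the restriction would then be locally constant, with zero second derivative. -/
theorem pderiv_pderiv_nonpos_of_isMax {f : Plane → ℝ} (hf : ContDiff ℝ ∞ f) {x : Plane}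
    (hx : ∀ y, f y ≤ f x) (i : Fin 2) : pderiv i (pderiv i f) x ≤ 0 := by
  by_contra! hpos
  set φ : ℝ → ℝ := fun r => f (x + r • Pi.single i 1) with hφ
  have h1 : deriv φ = fun r => pderiv i f (x + r • Pi.single i 1) :=
    funext fun r => (pderiv_eq_deriv_line hf i x r).deriv
  have h2 : deriv (deriv φ) 0 = pderiv i (pderiv i f) x := by
    rw [h1]
    simpa using (pderiv_eq_deriv_line (contDiff_pderiv hf i) i x 0).deriv
  have h0 : deriv φ 0 = 0 := by
    rw [h1]
    simpa using pderiv_eq_zero_of_isMax hx i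
  have hmin : IsLocalMin φ 0 := isLocalMin_of_deriv_deriv_pos (by rw [h2]; exact hpos) h0
    (pderiv_eq_deriv_line hf i x 0).continuousAt
  have hconst : φ =ᶠ[nhds 0] fun _ => φ 0 := by
    filter_upwards [hmin] with r hr
    refine le_antisymm ?_ hr
    simpa [hφ] using hx (x + r • Pi.single i 1)
  have h3 : deriv (deriv φ) 0 = 0 := by
    have := hconst.deriv.deriv_eq
    simpa using this
  linarith

/-- At a maximum of `d - (R + ε)(s - a)` with `s > a` the gradient vanishes, whatever `V` is, the
Laplacian is nonpositive and the time derivative of `d` is at least `R + ε`, against the residual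
bound `R`. So the maximum sits at `s = a`. -/
theorem le_of_parabolic_le {a b κ R M : ℝ} (hκ : 0 ≤ κ) {d : ℝ → Plane → ℝ}
    (hd : SmoothOnTorusTime a b d) (V : ℝ → Plane → Plane)
    (h : ∀ s ∈ Set.Ioo a b, ∀ x,
      deriv (fun r => d r x) s + advect (V s) (d s) x - κ * laplace (d s) x ≤ R)
    (h0 : ∀ x, d a x ≤ M) {t : ℝ} (ht : t ∈ Set.Icc a b) (x : Plane) :
    d t x ≤ M + R * (t - a) := by
  -- Taking `t < b` keeps the maximising time inside the open interval, where the equation holds; `t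
  -- = b` follows by continuity.
  have interior : ∀ t ∈ Set.Ico a b, ∀ x, ∀ ε > 0, d t x ≤ M + (R + ε) * (t - a) := by
    intro t ht x ε hε
    have hsub : Set.Icc a t ⊆ Set.Icc a b := Set.Icc_subset_Icc_right ht.2.le
    have hcont : ContinuousOn (fun p : ℝ × Plane => d p.1 p.2 - (R + ε) * (p.1 - a))
        (Set.Icc a t ×ˢ cell) :=
      (hd.smooth.continuousOn.mono (Set.prod_mono hsub (Set.subset_univ _))).sub (by fun_prop)
    obtain ⟨y, hy, hxy⟩ := exists_mem_cell x
    obtain ⟨⟨s, z⟩, ⟨hs, hz⟩, hmax⟩ := (isCompact_Icc.prod isCompact_cell).exists_isMaxOn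
      ⟨(t, y), ⟨⟨ht.1, le_rfl⟩, hy⟩⟩ hcont
    have hmax' : ∀ r ∈ Set.Icc a t, ∀ w, d r w - (R + ε) * (r - a) ≤ d s z - (R + ε) * (s - a) := by
      intro r hr w
      obtain ⟨w', hw', hww⟩ := exists_mem_cell w
      rw [hww _ (hd.periodic r (hsub hr))]
      exact hmax (a := (r, w')) ⟨hr, hw'⟩
    have hfin := hmax' t ⟨ht.1, le_rfl⟩ x
    rcases eq_or_lt_of_le hs.1 with rfl | has
    · have := h0 z
      simp only [sub_self, mul_zero, sub_zero] at hfin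
      linarith
    · exfalso
      have hsb : s ∈ Set.Ioo a b := ⟨has, hs.2.trans_lt ht.2⟩
      have hspace : ∀ w, d s w ≤ d s z := fun w => by
        have := hmax' s hs w
        linarith
      have hadv : advect (V s) (d s) z = 0 := by
        simp [advect, pderiv_eq_zero_of_isMax hspace]
      have hlap : laplace (d s) z ≤ 0 :=
        Finset.sum_nonpos fun i _ =>
          pderiv_pderiv_nonpos_of_isMax (hd.slice (hsub hs)) hspace i
      -- Only slopes from the left are used, since the maximum may occur at the final time `s = t`.
      have hderiv : R + ε ≤ deriv (fun r => d r z) s := by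
        have hD := (hd.differentiableAt_time z hsb).hasDerivAt
        have hslope := hD.tendsto_slope.mono_left
          (nhdsWithin_mono s (fun r (hr : r ∈ Set.Iio s) => ne_of_lt hr))
        refine ge_of_tendsto hslope ?_
        filter_upwards [Ioo_mem_nhdsLT has] with r hr
        rw [slope_def_field, le_div_iff_of_neg (by linarith [hr.2])]
        have := hmax' r ⟨hr.1.le, hr.2.le.trans hs.2⟩ z
        linarith
      have := h s hsb z
      have := mul_nonneg_of_nonpos_of_nonpos hlap (neg_nonpos.2 hκ)
      rw [hadv] at *
      linarith
  have interior' : ∀ t ∈ Set.Ico a b, d t x ≤ M + R * (t - a) := fun t ht => by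
    refine ge_of_tendsto (x := nhdsWithin (0 : ℝ) (Set.Ioi 0))
      (f := fun ε => M + (R + ε) * (t - a)) ?_ ?_
    · have : Continuous fun ε : ℝ => M + (R + ε) * (t - a) := by fun_prop
      simpa using (this.tendsto 0).mono_left nhdsWithin_le_nhds
    · filter_upwards [self_mem_nhdsWithin] with ε hε using interior t ht x ε hε
  rcases eq_or_lt_of_le (ht.1.trans ht.2) with hab | hab
  · have : t = a := le_antisymm (hab ▸ ht.2) ht.1
    subst this
    simpa using h0 x
  · have hcl : t ∈ closure (Set.Ico a b) := by rwa [closure_Ico hab.ne]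
    have hc : ContinuousOn (fun s => d s x) (closure (Set.Ico a b)) := by
      rw [closure_Ico hab.ne]; exact (hd.contDiffOn_time x).continuousOn
    exact le_on_closure interior' hc (by fun_prop) hcl

/-- The maximum principle applied to `u - w` and `w - u`. Taking `κ = 0` serves transport, and `V =
0` serves the heat equation. -/
theorem abs_sub_le_of_residual {a b κ R M : ℝ} (hκ : 0 ≤ κ) {u w : ℝ → Plane → ℝ}
    (hu : SmoothOnTorusTime a b u) (hw : SmoothOnTorusTime a b w) (V : ℝ → Plane → Plane)
    (h : ∀ s ∈ Set.Ioo a b, ∀ x,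
      |(deriv (fun r => u r x) s + advect (V s) (u s) x - κ * laplace (u s) x) -
        (deriv (fun r => w r x) s + advect (V s) (w s) x - κ * laplace (w s) x)| ≤ R)
    (h0 : ∀ x, |u a x - w a x| ≤ M) {t : ℝ} (ht : t ∈ Set.Icc a b) (x : Plane) :
    |u t x - w t x| ≤ M + R * (t - a) := by
  have key : ∀ u w : ℝ → Plane → ℝ, SmoothOnTorusTime a b u → SmoothOnTorusTime a b w →
      ∀ s ∈ Set.Ioo a b, ∀ x,
      deriv (fun r => u r x - w r x) s + advect (V s) (fun y => u s y - w s y) x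
        - κ * laplace (fun y => u s y - w s y) x =
      (deriv (fun r => u r x) s + advect (V s) (u s) x - κ * laplace (u s) x) -
        (deriv (fun r => w r x) s + advect (V s) (w s) x - κ * laplace (w s) x) := by
    intro u w hu hw s hs x
    have hs' := Set.Ioo_subset_Icc_self hs
    have e : (fun y => u s y - w s y) = fun y => u s y + (-1) * w s y := by
      funext y; ring
    rw [deriv_fun_sub (hu.differentiableAt_time x hs) (hw.differentiableAt_time x hs), e,
      advect_add_const_mul (hu.slice hs') (hw.slice hs'),
      laplace_add_const_mul (hu.slice hs') (hw.slice hs')]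
    ring
  rw [abs_le']
  constructor
  · refine le_of_parabolic_le hκ (hu.sub hw) V (fun s hs x => ?_)
      (fun x => (le_abs_self _).trans (h0 x)) ht x
    rw [key u w hu hw s hs x]
    exact (le_abs_self _).trans (h s hs x)
  · rw [neg_sub]
    refine le_of_parabolic_le hκ (hw.sub hu) V (fun s hs x => ?_)
      (fun x => (le_abs_self _).trans (by rw [abs_sub_comm]; exact h0 x)) ht x
    rw [key w u hw hu s hs x]
    exact (le_abs_self _).trans (by rw [abs_sub_comm]; exact h s hs x)

end MaximumPrinciple

/-! ### Local error of one step and its accumulation. -/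

section Splitting

theorem abs_advect_le {V : Plane → Plane} {f : Plane → ℝ} {x : Plane} {C D : ℝ} (hC : 0 ≤ C)
    (hV : ∀ i, |V x i| ≤ C) (hf : ∀ i, |pderiv i f x| ≤ D) : |advect V f x| ≤ 2 * (C * D) := by
  have h : ∀ i, |V x i * pderiv i f x| ≤ C * D := fun i => by
    rw [abs_mul]
    exact mul_le_mul (hV i) (hf i) (abs_nonneg _) hC
  unfold advect
  rw [Fin.sum_univ_two]
  exact (abs_add_le _ _).trans (by linarith [h 0, h 1])

theorem advect_sub_left (V W : Plane → Plane) (f : Plane → ℝ) (x : Plane) :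
    advect V f x - advect W f x = advect (fun y => V y - W y) f x := by
  simp only [advect, Fin.sum_univ_two, Pi.sub_apply]
  ring

theorem advect_zero_left (f : Plane → ℝ) (x : Plane) : advect (fun _ => 0) f x = 0 := by
  simp [advect]

/-- The affine-in-time function `u + c (s - a) v` is smooth. -/
theorem SmoothOnTorus.affine {u v : Plane → ℝ} (hu : SmoothOnTorus u) (hv : SmoothOnTorus v)
    (a b c : ℝ) : SmoothOnTorusTime a b (fun s x => u x + c * (s - a) * v x) :=
  hu.smoothOnTorusTime.add
    ((smoothOnTorusTime_of_contDiff (by fun_prop)).mul hv.smoothOnTorusTime)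

theorem deriv_affine (p q a c s : ℝ) : deriv (fun r : ℝ => p + c * (r - a) * q) s = c * q := by
  have h := ((((hasDerivAt_id s).sub_const a).const_mul c).mul_const q).const_add p
  simpa only [mul_one, id] using h.deriv

variable {ν T : ℝ} {U : ℝ → Plane → Plane} {g : ℝ → Plane → ℝ}

theorem IsTransportSolution.abs_sub_affine_le {a t K η M : ℝ} (ht : t ∈ Set.Icc a T)
    {b f v : Plane → ℝ} {w : ℝ → Plane → ℝ} (hw : IsTransportSolution T U a b w)
    (hf : SmoothOnTorus f) (hv : SmoothOnTorus v) (hvf : ∀ x, v x = advect (U a) f x)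
    (hK : 0 ≤ K) (hη : 0 ≤ η) (hU : ∀ s ∈ Set.Icc a t, ∀ x i, |U s x i| ≤ K)
    (hUa : ∀ s ∈ Set.Icc a t, ∀ x i, |U s x i - U a x i| ≤ η)
    (hfK : ∀ i x, |pderiv i f x| ≤ K) (hvK : ∀ i x, |pderiv i v x| ≤ K)
    (h0 : ∀ x, |b x - f x| ≤ M) (x : Plane) :
    |w t x - (f x + -1 * (t - a) * v x)| ≤
      M + (2 * (η * K) + (t - a) * (2 * (K * K))) * (t - a) := by
  refine abs_sub_le_of_residual (κ := 0) le_rfl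
    (hw.smooth.mono (Set.Icc_subset_Icc_right ht.2)) (hf.affine hv a t (-1)) U
    (fun s hs x => ?_) (fun x => ?_) ⟨ht.1, le_rfl⟩ x
  · have hs' := Set.Ioo_subset_Icc_self hs
    rw [hw.equation s ⟨hs.1, hs.2.trans_le ht.2⟩ x, deriv_affine,
      advect_add_const_mul hf.smooth hv.smooth, hvf x]
    -- The choice of `v` cancels the leading term, leaving the time increment of `U` against `∇f`
    -- and a term with factor `s - a`.
    have e : (0 - 0 * laplace (w s) x - (-1 * advect (U a) f x + (advect (U s) f x +
        -1 * (s - a) * advect (U s) v x) - 0 * laplace (fun x => f x + -1 * (s - a) * v x) x)) =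
        -advect (fun y => U s y - U a y) f x + (s - a) * advect (U s) v x := by
      rw [← advect_sub_left]; ring
    rw [e]
    have h1 := abs_advect_le (V := fun y => U s y - U a y) (f := f) (x := x) hη
      (fun i => hUa s hs' x i) (fun i => hfK i x)
    have h2 := abs_advect_le (V := U s) (f := v) (x := x) hK (fun i => hU s hs' x i)
      (fun i => hvK i x)
    refine (abs_add_le _ _).trans (add_le_add (by rwa [abs_neg]) ?_)
    rw [abs_mul, abs_of_nonneg (sub_nonneg.2 hs'.1)]
    exact mul_le_mul (by linarith [hs'.2]) h2 (abs_nonneg _) (by linarith [hs'.1, hs'.2])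
  · simpa [hw.initial] using h0 x

/-- The heat flow starts from the profile already transported up to the final time `t`, so `-(t - a)
v` stays frozen while the heat time runs. The choice of `q` cancels `νΔf`, leaving only `Δv` and
`Δq`, each with a small factor. -/
theorem IsHeatSolution.abs_sub_affine_le {a t K η M : ℝ} (hν : 0 ≤ ν) (ht : t ∈ Set.Icc a T)
    {b f v q : Plane → ℝ} {w : ℝ → Plane → ℝ} (hw : IsHeatSolution ν T g a b w)
    (hf : SmoothOnTorus f) (hv : SmoothOnTorus v) (hq : SmoothOnTorus q)
    (hqf : ∀ x, q x = ν * laplace f x + g a x)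
    (hga : ∀ s ∈ Set.Icc a t, ∀ x, |g s x - g a x| ≤ η)
    (hvK : ∀ x, |laplace v x| ≤ K) (hqK : ∀ x, |laplace q x| ≤ K)
    (h0 : ∀ x, |b x - (f x + -1 * (t - a) * v x)| ≤ M) (x : Plane) :
    |w t x - (f x + -1 * (t - a) * v x + 1 * (t - a) * q x)| ≤
      M + (η + (t - a) * (2 * (ν * K))) * (t - a) := by
  have hfv : SmoothOnTorus (fun x => f x + -1 * (t - a) * v x) :=
    (hf.affine hv a t (-1)).slice_torus ⟨ht.1, le_rfl⟩
  refine abs_sub_le_of_residual (κ := ν) hν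
    (hw.smooth.mono (Set.Icc_subset_Icc_right ht.2)) (hfv.affine hq a t 1) (fun _ _ => 0)
    (fun s hs x => ?_) (fun x => ?_) ⟨ht.1, le_rfl⟩ x
  · have hs' := Set.Ioo_subset_Icc_self hs
    rw [hw.equation s ⟨hs.1, hs.2.trans_le ht.2⟩ x, deriv_affine, advect_zero_left, advect_zero_left,
      laplace_add_const_mul hfv.smooth hq.smooth, laplace_add_const_mul hf.smooth hv.smooth, hqf x]
    have e : ν * laplace (w s) x + g s x + 0 - ν * laplace (w s) x -
        (1 * (ν * laplace f x + g a x) + 0 - ν * (laplace f x + -1 * (t - a) * laplace v x +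
          1 * (s - a) * laplace q x)) =
        (g s x - g a x) + (-((t - a) * (ν * laplace v x)) + (s - a) * (ν * laplace q x)) := by
      ring
    rw [e]
    have h1 : |(t - a) * (ν * laplace v x)| ≤ (t - a) * (ν * K) := by
      rw [abs_mul, abs_mul, abs_of_nonneg hν, abs_of_nonneg (sub_nonneg.2 ht.1)]
      exact mul_le_mul_of_nonneg_left (mul_le_mul_of_nonneg_left (hvK x) hν) (sub_nonneg.2 ht.1)
    have h2 : |(s - a) * (ν * laplace q x)| ≤ (t - a) * (ν * K) := by
      rw [abs_mul, abs_mul, abs_of_nonneg hν, abs_of_nonneg (sub_nonneg.2 hs'.1)]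
      exact mul_le_mul (by linarith [hs'.2]) (mul_le_mul_of_nonneg_left (hqK x) hν)
        (mul_nonneg hν (abs_nonneg _)) (sub_nonneg.2 ht.1)
    refine (abs_add_le _ _).trans (add_le_add (hga s hs' x) ((abs_add_le _ _).trans ?_))
    rw [abs_neg]
    linarith
  · simpa [hw.initial] using h0 x

/-- With neither advection nor diffusion, the comparison reduces to the mean value inequality in
time. -/
theorem SmoothOnTorusTime.abs_sub_affine_le {a t η : ℝ} (hat : a ≤ t) {w F : ℝ → Plane → ℝ}
    (hw : SmoothOnTorusTime a t w) {v q : Plane → ℝ} (hv : SmoothOnTorus v) (hq : SmoothOnTorus q)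
    (hF : ∀ s ∈ Set.Ioo a t, ∀ x, deriv (fun r => w r x) s = F s x)
    (hη : ∀ s ∈ Set.Icc a t, ∀ x, |F s x - (q x - v x)| ≤ η) (x : Plane) :
    |w t x - (w a x + -1 * (t - a) * v x + 1 * (t - a) * q x)| ≤ η * (t - a) := by
  have hwa := hw.slice_torus (t := a) ⟨le_rfl, hat⟩
  have hqv : SmoothOnTorus (fun x => q x - v x) :=
    (hq.smoothOnTorusTime (a := 0) (b := 0)).sub hv.smoothOnTorusTime |>.slice_torus (t := 0)
      (by simp)
  have h := abs_sub_le_of_residual (κ := 0) (R := η) (M := 0) le_rfl hw (hwa.affine hqv a t 1)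
    (fun _ _ => 0) (fun s hs x => ?_) (fun x => by simp) ⟨hat, le_rfl⟩ x
  · convert h using 2 <;> ring
  · rw [hF s hs x, deriv_affine, advect_zero_left, advect_zero_left]
    simpa using hη s (Set.Ioo_subset_Icc_self hs) x

/-- Local error of the splitting: over a short step the uniform error grows by at most `ε` times
the length of the step. -/
theorem exists_splitting_step (hν : 0 ≤ ν) (hT : 0 < T) (hU : SmoothOnTorusTime 0 T U)
    (hg : SmoothOnTorusTime 0 T g) {β₀ : Plane → ℝ} {β : ℝ → Plane → ℝ}
    (hβ : IsAdvectionDiffusionSolution ν T U g β₀ β) {ε : ℝ} (hε : 0 < ε) :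
    ∃ δ > 0, ∀ a t, 0 ≤ a → a ≤ t → t ≤ T → t - a < δ → ∀ b m c : Plane → ℝ,
      TransportOp T U a t b m → HeatOp ν T g a t m c → ∀ M, (∀ x, |β a x - b x| ≤ M) →
      ∀ x, |β t x - c x| ≤ M + ε * (t - a) := by
  set A : ℝ → Plane → ℝ := fun t => advect (U t) (β t) with hA
  set G : ℝ → Plane → ℝ := fun t x => ν * laplace (β t) x + g t x with hG
  have sA : SmoothOnTorusTime 0 T A := hU.advect hT hβ.smooth
  have sG : SmoothOnTorusTime 0 T G :=
    ((smoothOnTorusTime_of_contDiff contDiff_const).mul (hβ.smooth.laplace hT)).add hg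
  have sF := sG.sub sA
  obtain ⟨K, hK, bU, bβ, bA, bLA, bLG⟩ : ∃ K, 0 ≤ K ∧
      (∀ t ∈ Set.Icc 0 T, ∀ x i, |U t x i| ≤ K) ∧
      (∀ t ∈ Set.Icc 0 T, ∀ i x, |pderiv i (β t) x| ≤ K) ∧
      (∀ t ∈ Set.Icc 0 T, ∀ i x, |pderiv i (A t) x| ≤ K) ∧
      (∀ t ∈ Set.Icc 0 T, ∀ x, |laplace (A t) x| ≤ K) ∧
      (∀ t ∈ Set.Icc 0 T, ∀ x, |laplace (G t) x| ≤ K) := by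
    choose C1 n1 h1 using fun i => (hU.component i).exists_bound
    choose C2 n2 h2 using fun i => (hβ.smooth.pderiv hT i).exists_bound
    choose C3 n3 h3 using fun i => (sA.pderiv hT i).exists_bound
    obtain ⟨C4, n4, h4⟩ := (sA.laplace hT).exists_bound
    obtain ⟨C5, n5, h5⟩ := (sG.laplace hT).exists_bound
    have l : ∀ C : Fin 2 → ℝ, (∀ i, 0 ≤ C i) → ∀ i, C i ≤ ∑ j, C j := fun C hC i =>
      Finset.single_le_sum (fun j _ => hC j) (Finset.mem_univ i)
    have p1 := Finset.sum_nonneg fun i (_ : i ∈ Finset.univ) => n1 i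
    have p2 := Finset.sum_nonneg fun i (_ : i ∈ Finset.univ) => n2 i
    have p3 := Finset.sum_nonneg fun i (_ : i ∈ Finset.univ) => n3 i
    refine ⟨(∑ i, C1 i) + (∑ i, C2 i) + (∑ i, C3 i) + C4 + C5, by positivity,
      fun t ht x i => ?_, fun t ht i x => ?_, fun t ht i x => ?_, fun t ht x => ?_,
      fun t ht x => ?_⟩
    · linarith [h1 i t ht x, l C1 n1 i]
    · linarith [h2 i t ht x, l C2 n2 i]
    · linarith [h3 i t ht x, l C3 n3 i]
    · linarith [h4 t ht x]
    · linarith [h5 t ht x]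
  -- The oscillation terms total `(2K + 2) η = ε / 2`; `d4` below keeps the terms of size `(t - a)
  -- L` under the other `ε / 2`.
  set η : ℝ := ε / (4 * (K + 1)) with hη
  have hη0 : 0 < η := by positivity
  choose d1 dp1 m1 using fun i => (hU.component i).exists_modulus hη0
  obtain ⟨d2, dp2, m2⟩ := hg.exists_modulus hη0
  obtain ⟨d3, dp3, m3⟩ := sF.exists_modulus hη0
  set L : ℝ := 2 * (K * K) + 2 * (ν * K) with hL
  have hL0 : 0 ≤ L := by positivity
  set d4 : ℝ := ε / (2 * (L + 1)) with hd4
  have dp4 : 0 < d4 := by positivity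
  refine ⟨min (min (d1 0) (d1 1)) (min (min d2 d3) d4),
    lt_min (lt_min (dp1 0) (dp1 1)) (lt_min (lt_min dp2 dp3) dp4), ?_⟩
  intro a t ha hat htT hδ b m c ⟨w, hw, hm⟩ ⟨z, hz, hc⟩ M hM x
  simp only [lt_min_iff] at hδ
  obtain ⟨⟨hδ0, hδ1⟩, ⟨hδ2, hδ3⟩, hδ4⟩ := hδ
  have haT : a ∈ Set.Icc 0 T := ⟨ha, hat.trans htT⟩
  have hsub : ∀ s ∈ Set.Icc a t, s ∈ Set.Icc 0 T := fun s hs =>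
    ⟨ha.trans hs.1, hs.2.trans htT⟩
  have habs : ∀ s ∈ Set.Icc a t, ∀ d, t - a < d → |s - a| < d := fun s hs d hd => by
    rw [abs_of_nonneg (sub_nonneg.2 hs.1)]
    linarith [hs.2]
  have hδU : ∀ i, t - a < d1 i := by
    intro i
    fin_cases i
    exacts [hδ0, hδ1]
  have e1 := hw.abs_sub_affine_le ⟨hat, htT⟩ (hβ.smooth.slice_torus haT)
    (sA.slice_torus haT) (fun _ => rfl) hK hη0.le (fun s hs => bU s (hsub s hs))
    (fun s hs x i => m1 i s (hsub s hs) a haT (habs s hs _ (hδU i)) x) (bβ a haT) (bA a haT)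
    (M := M) (fun x => by rw [abs_sub_comm]; exact hM x)
  have e2 := hz.abs_sub_affine_le hν ⟨hat, htT⟩ (hβ.smooth.slice_torus haT)
    (sA.slice_torus haT) (sG.slice_torus haT) (fun _ => rfl)
    (fun s hs x => m2 s (hsub s hs) a haT (habs s hs _ hδ2) x) (bLA a haT) (bLG a haT)
    (fun x => by rw [hm]; exact e1 x) x
  have e3 := (hβ.smooth.mono (Set.Icc_subset_Icc ha htT)).abs_sub_affine_le hat
    (sA.slice_torus haT) (sG.slice_torus haT) (F := fun s x => G s x - A s x)
    (fun s hs x => by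
      have := hβ.equation s ⟨ha.trans_lt hs.1, hs.2.trans_le htT⟩ x
      simp only [hG, hA]
      linarith)
    (fun s hs x => m3 s (hsub s hs) a haT (habs s hs _ hδ3) x) x
  rw [← hc, abs_sub_comm] at e2
  have htri := abs_sub_le (β t x) (β a x + -1 * (t - a) * A a x + 1 * (t - a) * G a x) (c x)
  have hR : 2 * (η * K) + (t - a) * (2 * (K * K)) + (η + (t - a) * (2 * (ν * K))) + η ≤ ε := by
    have q1 : η * (4 * (K + 1)) = ε := div_mul_cancel₀ _ (by positivity)
    have q2 : d4 * (2 * (L + 1)) = ε := div_mul_cancel₀ _ (by positivity)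
    have q3 : (t - a) * L ≤ d4 * L := mul_le_mul_of_nonneg_right hδ4.le hL0
    rw [hL] at q2 q3
    linarith
  have := mul_le_mul_of_nonneg_right hR (sub_nonneg.2 hat)
  linarith

/-- Local bounds `ε (t - a)` telescope because earlier error is passed on with factor one. Both
flows run to the same `t`, so off-grid times need only one last, shorter step. -/
theorem IsSplittingApproximant.abs_sub_le {β₀ : Plane → ℝ} {N : ℕ} (hN : 0 < N) (hT : 0 < T)
    {B β : ℝ → Plane → ℝ} (hB : IsSplittingApproximant ν T U g β₀ N B) (h0 : β 0 = β₀) {ε : ℝ}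
    (hstep : ∀ a t, 0 ≤ a → a ≤ t → t ≤ T → t - a ≤ T / N → ∀ b m c : Plane → ℝ,
      TransportOp T U a t b m → HeatOp ν T g a t m c → ∀ M, (∀ x, |β a x - b x| ≤ M) →
      ∀ x, |β t x - c x| ≤ M + ε * (t - a))
    {t : ℝ} (ht : t ∈ Set.Icc 0 T) (x : Plane) : |β t x - B t x| ≤ ε * t := by
  have hN' : (0 : ℝ) < N := by exact_mod_cast hN
  have hτ : 0 < T / N := by positivity
  have grid_nonneg : ∀ n, 0 ≤ gridTime T N n := fun n => by unfold gridTime; positivity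
  have grid_succ : ∀ n, gridTime T N (n + 1) = gridTime T N n + T / N := fun n => by
    unfold gridTime; push_cast; ring
  have grid_le : ∀ n ≤ N, gridTime T N n ≤ T := fun n hn => by
    have : (n : ℝ) ≤ N := by exact_mod_cast hn
    calc (n : ℝ) * (T / N) ≤ N * (T / N) := mul_le_mul_of_nonneg_right this hτ.le
      _ = T := by field_simp
  have cell_step : ∀ n < N, (∀ x, |β (gridTime T N n) x - B (gridTime T N n) x| ≤
      ε * gridTime T N n) → ∀ t ∈ Set.Ioc (gridTime T N n) (gridTime T N (n + 1)),
      ∀ x, |β t x - B t x| ≤ ε * t := by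
    intro n hn ih t ht x
    obtain ⟨m, hE, hH⟩ := hB.step n hn t ht
    have := hstep _ t (grid_nonneg n) ht.1.le (ht.2.trans (grid_le _ hn))
      (by linarith [ht.2, grid_succ n]) _ _ _ hE hH _ ih x
    linarith
  have grid : ∀ n ≤ N, ∀ x, |β (gridTime T N n) x - B (gridTime T N n) x| ≤
      ε * gridTime T N n := by
    intro n
    induction n with
    | zero => intro _ x; simp [gridTime, hB.initial, h0]
    | succ n ih =>
      intro hn
      exact cell_step n hn (ih (Nat.le_of_succ_le hn)) _
        ⟨by linarith [grid_succ n], le_rfl⟩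
  rcases eq_or_lt_of_le ht.1 with rfl | htpos
  · simp [hB.initial, h0]
  -- Ceiling minus one, not floor: the steps are open on the left and closed on the right.
  · obtain ⟨n, hn⟩ : ∃ n, ⌈t / (T / N)⌉₊ = n + 1 :=
      Nat.exists_eq_add_one.2 (Nat.ceil_pos.2 (by positivity))
    have hle : ⌈t / (T / N)⌉₊ ≤ N := by
      refine Nat.ceil_le.2 ((div_le_iff₀ hτ).2 ?_)
      rw [mul_div_cancel₀ _ hN'.ne']
      exact ht.2
    have hlo : (n : ℝ) < t / (T / N) := Nat.lt_ceil.1 (by omega)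
    have hhi : t / (T / N) ≤ ((n + 1 : ℕ) : ℝ) := hn ▸ Nat.le_ceil _
    exact cell_step n (by omega) (grid n (by omega)) t
      ⟨(lt_div_iff₀ hτ).1 hlo, (div_le_iff₀ hτ).1 hhi⟩ x

/-! ### From the sup norm to L², and the limit. -/

instance : MeasureTheory.IsFiniteMeasure torusMeasure :=
  ⟨by rw [torusMeasure, MeasureTheory.Measure.restrict_apply_univ]
      exact isCompact_cell.measure_lt_top⟩

theorem normLinftyL2_le {w : ℝ → Plane → ℝ} {C : ℝ} (h : ∀ t ∈ Set.Icc 0 T, ∀ x, |w t x| ≤ C) :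
    normLinftyL2 T w ≤ torusMeasure Set.univ ^ (2 : ENNReal).toReal⁻¹ * ENNReal.ofReal C :=
  iSup₂_le fun t ht => MeasureTheory.eLpNorm_le_of_ae_bound (.of_forall (h t ht))

end Splitting

end AdvDiff

theorem propositionA4 (ν T : ℝ) (hν : 0 < ν) (hT : 0 < T)
    (U : ℝ → AdvDiff.Plane → AdvDiff.Plane)
    (hU : AdvDiff.SmoothOnTorusTime 0 T U)
    (hdiv : ∀ t ∈ Set.Icc 0 T, ∀ x, AdvDiff.divergence (U t) x = 0)
    (g : ℝ → AdvDiff.Plane → ℝ)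
    (hg : AdvDiff.SmoothOnTorusTime 0 T g)
    (hg0 : ∀ t ∈ Set.Icc 0 T, AdvDiff.ZeroMean (g t))
    (β₀ : AdvDiff.Plane → ℝ)
    (hβ₀ : AdvDiff.SmoothOnTorus β₀)
    (hβ₀0 : AdvDiff.ZeroMean β₀)
    (β : ℝ → AdvDiff.Plane → ℝ)
    (hβ : AdvDiff.IsAdvectionDiffusionSolution ν T U g β₀ β)
    (βΔ : ℕ → ℝ → AdvDiff.Plane → ℝ)
    (hβΔ : ∀ N : ℕ, 0 < N → AdvDiff.IsSplittingApproximant ν T U g β₀ N (βΔ N)) :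
    Filter.Tendsto
      (fun N : ℕ => AdvDiff.normLinftyL2 T (fun t x => β t x - βΔ N t x))
      Filter.atTop (nhds 0) := by
  set L : ENNReal := AdvDiff.torusMeasure Set.univ ^ (2 : ENNReal).toReal⁻¹ with hL
  have hLtop : L ≠ ⊤ := ENNReal.rpow_ne_top_of_nonneg (by positivity)
    (MeasureTheory.measure_ne_top _ _)
  rw [ENNReal.tendsto_nhds_zero]
  intro e he
  rcases eq_or_ne e ⊤ with rfl | hetop
  · exact Filter.Eventually.of_forall fun _ => le_top
  have he' : 0 < e.toReal := ENNReal.toReal_pos he.ne' hetop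
  have hL0 : 0 ≤ L.toReal := ENNReal.toReal_nonneg
  -- Chosen so that `L ε T ≤ e`, where `L` is the constant of the embedding of L^∞ into L².
  set ε : ℝ := e.toReal / ((L.toReal + 1) * T) with hε
  have hε0 : 0 < ε := by positivity
  obtain ⟨δ, hδ, hstep⟩ := AdvDiff.exists_splitting_step hν.le hT hU hg hβ hε0
  have hlim := tendsto_const_div_atTop_nhds_zero_nat T
  filter_upwards [hlim.eventually (gt_mem_nhds hδ), Filter.eventually_gt_atTop 0] with N hNδ hN
  refine (AdvDiff.normLinftyL2_le (C := ε * T) fun t ht x => ?_).trans ?_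
  · refine ((hβΔ N hN).abs_sub_le hN hT hβ.initial
      (fun a t h1 h2 h3 h4 => hstep a t h1 h2 h3 (h4.trans_lt hNδ)) ht x).trans ?_
    exact mul_le_mul_of_nonneg_left ht.2 hε0.le
  · rw [← hL, ← ENNReal.ofReal_toReal hLtop, ← ENNReal.ofReal_mul hL0,
      ← ENNReal.ofReal_toReal hetop]
    refine ENNReal.ofReal_le_ofReal ?_
    have h1 : ε * T * (L.toReal + 1) = e.toReal := by
      rw [hε]; field_simp
    have h2 : 0 ≤ ε * T := by positivity
    linarith
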